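/- Fix an integer $n\ge 1$, a finite set $D$, and a predicate on $D$ that is satisfied by at least one and violated by at least one element of $D$. For a database $d\in D^n$ let $f(d)\in N=\{0,\dots,n\}$ be the number of rows of $d$ that satisfy the predicate; two databases are neighbors if they differ in exactly one row. A mechanism with countable range $R$ assigns to each $d\in D^n$ a probability distribution $(x_{dr})_{r\in R}$ on $R$. It is oblivious if $x_{d_1r}=x_{d_2r}$ for all $r$ whenever $f(d_1)=f(d_2)$; one then writes $x_{ir}$ for the common value of $x_{dr}$ over all $d$ with $f(d)=i$. For $\alpha\in[0,1]$ it is $\alpha$-differentially private if $\alpha\,x_{d_1r}\le x_{d_2r}$ and $\alpha\, x_{d_2r}\le x_{d_1r}$ for all neighbors $d_1,d_2$ and all $r\in R$ (i.e. $x_{d_1r}/x_{d_2r}\in[\alpha,1/\alpha]$, with $0/0=1$). A user consists of a probability distribution $(p_i)_{i\in N}$ (the prior) and a loss function $l:N\times N\to[0,\infty)$ such that, for each fixed $i$, $l(i,r)$ is nondecreasing in $|i-r|$. The user's expected loss from an oblivious mechanism $x$ with range $N$ is $\sum_{i\in N}p_i\sum_{r\in N}x_{ir}\,l(i,r)$.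 A remap of a mechanism $x$ with range $R$ is a family $y=(y_{r'r})_{r'\in R,\,r\in N}$ such that $(y_{r'r})_{r\in N}$ is a probability distribution for each $r'\in R$; it induces the mechanism $y\circ x$ with range $N$ given by $(y\circ x)_{dr}=\sum_{r'\in R}x_{dr'}\,y_{r'r}$. A remap $y$ of an oblivious mechanism $x$ is optimal for the user if $y\circ x$ has the least expected loss among all mechanisms induced by remaps of $x$. It is a Bayes remap if for each response $r'$ there is a query result $i^*$ that minimizes $k\mapsto\sum_{i\in N}p(i\mid r')\,l(i,k)$ over $N$, where $p(i\mid r')=x_{ir'}p_i/\sum_{j\in N}x_{jr'}p_j$, such that $y_{r'i^*}=1$ and $y_{r'k}=0$ for $k\ne i^*$ (if $\sum_{j}x_{jr'}p_j=0$, then $i^*$ may be any element of $N$). Let $\alpha\in[0,1]$. For $\alpha<1$ let $x^G$ be the $\alpha$-geometric mechanism, with range $\mathbb Z$: $x^G_{dz}=\frac{1-\alpha}{1+\alpha}\,\alpha^{|z-f(d)|}$ (with $0^0=1$). For $\alpha=1$, where this formula does not define a probability distribution, let $x^G$ be any mechanism with range $\mathbb Z$ whose output distribution does not depend on $d$. Theorem.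 For every user, a Bayes remap of $x^G$ exists, and every Bayes remap of $x^G$ is an optimal remap. For every optimal remap $y$ of $x^G$, the mechanism $y\circ x^G$ is oblivious and $\alpha$-differentially private, and it minimizes the user's expected loss over all oblivious $\alpha$-differentially private mechanisms with range $N$. -/

import Mathlib

namespace GeomPrivacy

open Classical in
/-- The number of rows of the database `d` satisfying the predicate `P`, as an element of
`N = {0, …, n}`. -/
noncomputable def countQuery {D : Type*} {n : ℕ} (P : D → Prop) (d : Fin n → D) : Fin (n + 1) :=
  ⟨(Finset.univ.filter (fun j : Fin n => P (d j))).card,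
    Nat.lt_succ_of_le ((Finset.card_filter_le _ _).trans (Finset.card_fin n).le)⟩

/-- Two databases are neighbors if they differ in exactly one row. -/
def Neighbors {D : Type*} {n : ℕ} (d₁ d₂ : Fin n → D) : Prop :=
  ∃ j, d₁ j ≠ d₂ j ∧ ∀ k, k ≠ j → d₁ k = d₂ k

/-- `x a r` is the probability of the response `r` on input `a`: every row of `x` is a
probability distribution on the range `R`. -/
def IsMechanism {A R : Type*} (x : A → R → ℝ) : Prop :=
  (∀ a r, 0 ≤ x a r) ∧ ∀ a, HasSum (x a) 1

/-- `α`-differential privacy: for neighbors, the ratio of the probabilities of each response lies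
in `[α, 1/α]`. The cross-multiplied form below, for `α ∈ [0, 1]`, treats `0/0` as `1`, and
`1/0` as `∞`. -/
def IsPrivate {D R : Type*} {n : ℕ} (α : ℝ) (x : (Fin n → D) → R → ℝ) : Prop :=
  ∀ d₁ d₂, Neighbors d₁ d₂ → ∀ r, α * x d₂ r ≤ x d₁ r ∧ α * x d₁ r ≤ x d₂ r

/-- The output distribution depends only on the query result. -/
def IsOblivious {D R : Type*} {n : ℕ} (P : D → Prop) (x : (Fin n → D) → R → ℝ) : Prop :=
  ∀ d₁ d₂, countQuery P d₁ = countQuery P d₂ → ∀ r, x d₁ r = x d₂ r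

/-- For an oblivious mechanism `x`, the probability `x_{ir}` of the response `r` when the query
result is `i`: the value of `x d r` at any database `d` with query result `i`. (Such a `d` exists
whenever the predicate is non-trivial.) -/
noncomputable def resultProb {D R : Type*} {n : ℕ} (P : D → Prop) (x : (Fin n → D) → R → ℝ)
    (i : Fin (n + 1)) (r : R) : ℝ :=
  open Classical in
  if h : ∃ d : Fin n → D, countQuery P d = i then x h.choose r else 0

/-- A user's prior: a probability distribution over the query results. -/
def IsPrior {n : ℕ} (p : Fin (n + 1) → ℝ) : Prop :=
  (∀ i, 0 ≤ p i) ∧ ∑ i, p i = 1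

/-- A loss function is nonnegative and, for each fixed `i`, nondecreasing in `|i - r|`. -/
def IsLoss {n : ℕ} (l : Fin (n + 1) → Fin (n + 1) → ℝ) : Prop :=
  (∀ i r, 0 ≤ l i r) ∧
    ∀ i r s : Fin (n + 1), |(i : ℤ) - (r : ℤ)| ≤ |(i : ℤ) - (s : ℤ)| → l i r ≤ l i s

/-- The user's expected loss from an oblivious mechanism with range `N`. -/
noncomputable def expectedLoss {D : Type*} {n : ℕ} (P : D → Prop) (p : Fin (n + 1) → ℝ)
    (l : Fin (n + 1) → Fin (n + 1) → ℝ) (x : (Fin n → D) → Fin (n + 1) → ℝ) : ℝ :=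
  ∑ i, p i * ∑ r, resultProb P x i r * l i r

/-- The mechanism `y ∘ x` induced by a mechanism `x` with range `R` and a remap `y`. -/
noncomputable def applyRemap {A R S : Type*} (y : R → S → ℝ) (x : A → R → ℝ) : A → S → ℝ :=
  fun a s => ∑' r, x a r * y r s

/-- `y` is an optimal remap of `x`: among all (randomized) reinterpretations of the responses of
`x` as query results, it induces a mechanism of least expected loss. -/
def IsOptimalRemap {D R : Type*} {n : ℕ} (P : D → Prop) (p : Fin (n + 1) → ℝ)
    (l : Fin (n + 1) → Fin (n + 1) → ℝ) (x : (Fin n → D) → R → ℝ)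
    (y : R → Fin (n + 1) → ℝ) : Prop :=
  IsMechanism y ∧ ∀ y' : R → Fin (n + 1) → ℝ, IsMechanism y' →
    expectedLoss P p l (applyRemap y x) ≤ expectedLoss P p l (applyRemap y' x)

/-- The posterior probability of the query result `i` given the response `r` of `x`. -/
noncomputable def posterior {D R : Type*} {n : ℕ} (P : D → Prop) (p : Fin (n + 1) → ℝ)
    (x : (Fin n → D) → R → ℝ) (r : R) (i : Fin (n + 1)) : ℝ :=
  (resultProb P x i r * p i) / ∑ i', resultProb P x i' r * p i'

/-- `y` is a Bayes remap of `x`: each response `r` is deterministically reinterpreted as a query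
result that minimizes the expected loss with respect to the posterior given `r`. (Responses of
total probability zero may be mapped anywhere.) -/
def IsBayesRemap {D R : Type*} {n : ℕ} (P : D → Prop) (p : Fin (n + 1) → ℝ)
    (l : Fin (n + 1) → Fin (n + 1) → ℝ) (x : (Fin n → D) → R → ℝ)
    (y : R → Fin (n + 1) → ℝ) : Prop :=
  ∀ r, ∃ k : Fin (n + 1),
    (∀ j, ∑ i, posterior P p x r i * l i k ≤ ∑ i, posterior P p x r i * l i j) ∧
    y r = Pi.single k 1

/-- `x` is an oblivious, `α`-differentially private mechanism. -/
def IsFeasible {D R : Type*} {n : ℕ} (P : D → Prop) (α : ℝ) (x : (Fin n → D) → R → ℝ) : Prop :=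
  IsMechanism x ∧ IsOblivious P x ∧ IsPrivate α x

/-- `x` minimizes the expected loss over all oblivious, `α`-differentially private mechanisms
with range `N` (and is one itself). -/
def IsOptimalMechanism {D : Type*} {n : ℕ} (P : D → Prop) (α : ℝ) (p : Fin (n + 1) → ℝ)
    (l : Fin (n + 1) → Fin (n + 1) → ℝ) (x : (Fin n → D) → Fin (n + 1) → ℝ) : Prop :=
  IsFeasible P α x ∧ ∀ x' : (Fin n → D) → Fin (n + 1) → ℝ, IsFeasible P α x' →
    expectedLoss P p l x ≤ expectedLoss P p l x'

/-- `x` is the `α`-geometric mechanism: it outputs the query result plus two-sided geometric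
noise. At `α = 1` the formula vanishes identically and gives no distribution; there `x` may be any
mechanism with range `ℤ` whose output distribution does not depend on the input. -/
def IsGeometricMechanism {D : Type*} {n : ℕ} (P : D → Prop) (α : ℝ)
    (x : (Fin n → D) → ℤ → ℝ) : Prop :=
  (α < 1 ∧ ∀ d z,
    x d z = (1 - α) / (1 + α) * α ^ (z - ((countQuery P d : ℕ) : ℤ)).natAbs) ∨
  (α = 1 ∧ IsMechanism x ∧ ∀ d₁ d₂ z, x d₁ z = x d₂ z)

end GeomPrivacy

namespace GeomPrivacy

open Finset

/-! The proof is linear programming duality with an explicit dual solution. Put `c r i = p i * l i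
r`, let `q r` be its image under the kernel `α ^ |z - i|`, and let `B` be the pointwise minimum of
the `q r`. For `α < 1`, `geomForm` inverts the kernel up to `1 - α ^ 2`, so the cost of giving
response `r` with probabilities `u` is, up to that factor, the form at `q r` and `u`. The key
inequality `HasMidpointCrossing.geomForm_le` says that replacing `q r` by `B` does not increase the
form when `u` is a column of a private mechanism. As rows sum to 1, summing over `r` gives a lower
bound on the loss that does not depend on the mechanism. It rests on monotonicity of the loss: `c a
- c b` changes sign only once, which orders the best responses and makes the excess `q r - B` obey
one-sided privacy inequalities on either side of a pivot (`exists_pivot`). The bound is attained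
(`expectedLoss_truncated_remap`): columns of a remapped geometric mechanism are mixtures of kernel
functions, on which the form evaluates the excess at the truncation of `z` to `[0, n]`, and a best
response there has no excess. Any optimal remap does at least as well. For `α = 1` privacy makes all
rows equal, and a constant response is optimal. Bayes remaps are optimal because the loss splits
over the responses. -/

/-! ### The inverse kernel as a bilinear form. -/

/-- The symmetric bilinear form represented, up to the factor `1 - α ^ 2`, by the inverse of the
matrix `α ^ |z - i|` with `0 ≤ i, z ≤ n`. -/
def geomForm (α : ℝ) (n : ℕ) (h u : ℕ → ℝ) : ℝ :=
  ∑ i ∈ range n, (h (i + 1) - α * h i) * (u (i + 1) - α * u i) + (1 - α ^ 2) * (h 0 * u 0)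

theorem geomForm_comm (α : ℝ) (n : ℕ) (h u : ℕ → ℝ) :
    geomForm α n h u = geomForm α n u h := by
  simp only [geomForm, mul_comm]

theorem geomForm_sub_left (α : ℝ) (n : ℕ) (h h' u : ℕ → ℝ) :
    geomForm α n (fun i => h i - h' i) u = geomForm α n h u - geomForm α n h' u := by
  simp only [geomForm, add_sub_add_comm, ← sum_sub_distrib]
  congr 1
  · exact sum_congr rfl fun i _ => by ring
  · ring

theorem geomForm_sum_right {ι : Type*} (s : Finset ι) (α : ℝ) (n : ℕ) (h : ℕ → ℝ)
    (u : ι → ℕ → ℝ) :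
    geomForm α n h (fun i => ∑ k ∈ s, u k i) = ∑ k ∈ s, geomForm α n h (u k) := by
  simp only [geomForm, sum_add_distrib, mul_sum]
  congr 1
  rw [sum_comm]
  refine sum_congr rfl fun i _ => ?_
  rw [← sum_sub_distrib, mul_sum]

theorem geomForm_const_mul_right (α : ℝ) (n : ℕ) (h u : ℕ → ℝ) (a : ℝ) :
    geomForm α n h (fun i => a * u i) = a * geomForm α n h u := by
  simp only [geomForm, mul_add, mul_sum]
  congr 1
  · exact sum_congr rfl fun i _ => by ring
  · ring

theorem geomForm_congr_right {α : ℝ} {n : ℕ} (h : ℕ → ℝ) {u v : ℕ → ℝ}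
    (huv : ∀ i ≤ n, u i = v i) : geomForm α n h u = geomForm α n h v := by
  simp only [geomForm]
  rw [huv 0 (Nat.zero_le n)]
  congr 1
  refine sum_congr rfl fun i hi => ?_
  have := mem_range.1 hi
  rw [huv i (by omega), huv (i + 1) (by omega)]

theorem hasSum_geomForm_right {ι : Type*} (α : ℝ) (n : ℕ) (h : ℕ → ℝ) {v : ι → ℕ → ℝ} {u : ℕ → ℝ}
    (hv : ∀ i ≤ n, HasSum (fun z => v z i) (u i)) :
    HasSum (fun z => geomForm α n h (v z)) (geomForm α n h u) := by
  refine HasSum.add (hasSum_sum fun i hi => ?_) (((hv 0 (Nat.zero_le n)).mul_left _).mul_left _)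
  have := mem_range.1 hi
  exact ((hv (i + 1) (by omega)).sub ((hv i (by omega)).mul_left _)).mul_left _

/-- The form can be expanded around any point `m` of `{0, …, n}`. -/
theorem geomForm_eq_pivot (α : ℝ) {m n : ℕ} (hm : m ≤ n) (h u : ℕ → ℝ) :
    geomForm α n h u = ∑ i ∈ range m, (h i - α * h (i + 1)) * (u i - α * u (i + 1)) +
      ∑ i ∈ Ico m n, (h (i + 1) - α * h i) * (u (i + 1) - α * u i) +
      (1 - α ^ 2) * (h m * u m) := by
  induction m with
  | zero => simp [geomForm]
  | succ m ih =>
    -- The `m`-th term of the right sum plus the pivot term equals `h m * u m + h (m+1) * u (m+1) -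
    -- α * (h m * u (m+1) + h (m+1) * u m)`, which is symmetric in `m` and `m + 1`.
    rw [ih (by omega), sum_range_succ, sum_eq_sum_Ico_succ_bot (by omega : m < n)]
    ring

/-- The hypotheses say that `m` is the truncation of `z` to `[0, n]`. Away from `z` the kernel
decays by exactly `α` per step, so in the expansion around `m` only the pivot term survives. -/
theorem geomForm_geometric (α : ℝ) {m n : ℕ} (hm : m ≤ n) (h : ℕ → ℝ) (z : ℤ)
    (hlo : 0 < m → (m : ℤ) ≤ z) (hhi : m < n → z ≤ m) :
    geomForm α n h (fun i => α ^ (z - (i : ℤ)).natAbs) =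
      (1 - α ^ 2) * (h m * α ^ (z - (m : ℤ)).natAbs) := by
  rw [geomForm_eq_pivot α hm]
  rw [sum_eq_zero, sum_eq_zero, zero_add, zero_add]
  · intro i hi
    have := mem_Ico.1 hi
    have e : (z - ((i + 1 : ℕ) : ℤ)).natAbs = (z - (i : ℤ)).natAbs + 1 := by omega
    rw [e, pow_succ]; ring
  · intro i hi
    have := mem_range.1 hi
    have e : (z - (i : ℤ)).natAbs = (z - ((i + 1 : ℕ) : ℤ)).natAbs + 1 := by omega
    rw [e, pow_succ]; ring

/-! ### Potentials of weights. -/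

/-- The potential of the weights `c` with respect to the kernel `α ^ |z - i|`. -/
def geomPotential (α : ℝ) (n : ℕ) (c : ℕ → ℝ) (z : ℕ) : ℝ :=
  ∑ i ∈ range (n + 1), c i * α ^ ((i : ℤ) - (z : ℤ)).natAbs

theorem geomPotential_sub (α : ℝ) (n : ℕ) (c c' : ℕ → ℝ) (z : ℕ) :
    geomPotential α n (fun i => c i - c' i) z = geomPotential α n c z - geomPotential α n c' z := by
  simp only [geomPotential, ← sum_sub_distrib, sub_mul]

theorem geomForm_geomPotential (α : ℝ) (n : ℕ) (c u : ℕ → ℝ) :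
    geomForm α n (geomPotential α n c) u = (1 - α ^ 2) * ∑ i ∈ range (n + 1), c i * u i := by
  rw [geomForm_comm]
  unfold geomPotential
  rw [geomForm_sum_right, mul_sum]
  refine sum_congr rfl fun i hi => ?_
  have := mem_range.1 hi
  rw [geomForm_const_mul_right,
    geomForm_geometric α (m := i) (by omega) u i (fun _ => le_rfl) (fun _ => le_rfl)]
  simp only [sub_self, Int.natAbs_zero, pow_zero]
  ring

/-- The part of the potential at `z` due to the weights in `[0, z]`. -/
def lowerPotential (α : ℝ) (c : ℕ → ℝ) (z : ℕ) : ℝ :=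
  ∑ i ∈ range (z + 1), c i * α ^ (z - i)

/-- The part of the potential at `z` due to the weights in `[z, n]`. -/
def upperPotential (α : ℝ) (n : ℕ) (c : ℕ → ℝ) (z : ℕ) : ℝ :=
  ∑ i ∈ Ico z (n + 1), c i * α ^ (i - z)

theorem geomPotential_eq {α : ℝ} {n z : ℕ} (c : ℕ → ℝ) (hz : z < n) :
    geomPotential α n c z = lowerPotential α c z + α * upperPotential α n c (z + 1) := by
  unfold geomPotential lowerPotential upperPotential
  rw [← sum_range_add_sum_Ico _ (by omega : z + 1 ≤ n + 1), mul_sum]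
  congr 1
  · refine sum_congr rfl fun i hi => ?_
    have := mem_range.1 hi
    rw [show ((i : ℤ) - (z : ℤ)).natAbs = z - i by omega]
  · refine sum_congr rfl fun i hi => ?_
    have := mem_Ico.1 hi
    rw [show ((i : ℤ) - (z : ℤ)).natAbs = i - (z + 1) + 1 by omega, pow_succ]
    ring

theorem geomPotential_succ_eq {α : ℝ} {n z : ℕ} (c : ℕ → ℝ) (hz : z < n) :
    geomPotential α n c (z + 1) = α * lowerPotential α c z + upperPotential α n c (z + 1) := by
  unfold geomPotential lowerPotential upperPotential
  rw [← sum_range_add_sum_Ico _ (by omega : z + 1 ≤ n + 1), mul_sum]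
  congr 1
  · refine sum_congr rfl fun i hi => ?_
    have := mem_range.1 hi
    rw [show ((i : ℤ) - ((z + 1 : ℕ) : ℤ)).natAbs = z - i + 1 by omega, pow_succ]
    ring
  · refine sum_congr rfl fun i hi => ?_
    have := mem_Ico.1 hi
    rw [show ((i : ℤ) - ((z + 1 : ℕ) : ℤ)).natAbs = i - (z + 1) by omega]

/-! ### Single crossing and feasibility of the dual solution. -/

/-- For `a < b`, the differences `c a - c b` change sign at most once, at `(a + b) / 2`, from
nonpositive to nonnegative. -/
def HasMidpointCrossing (n : ℕ) (c : ℕ → ℕ → ℝ) : Prop :=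
  ∀ a b i, a < b → b ≤ n → i ≤ n →
    (2 * i ≤ a + b → c a i ≤ c b i) ∧ (a + b ≤ 2 * i → c b i ≤ c a i)

/-- The cut between `z` and `z + 1` cannot have the sign change strictly on both sides: either all
weights up to `z` are nonpositive or all weights beyond it are nonnegative. -/
theorem HasMidpointCrossing.lower_nonpos_or_upper_nonneg {α : ℝ} (hα : 0 ≤ α) {n : ℕ}
    {c : ℕ → ℕ → ℝ} (hc : HasMidpointCrossing n c) {a b z : ℕ} (hab : a < b) (hb : b ≤ n)
    (hz : z < n) :
    lowerPotential α (fun i => c a i - c b i) z ≤ 0 ∨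
      0 ≤ upperPotential α n (fun i => c a i - c b i) (z + 1) := by
  by_cases h : 2 * z ≤ a + b
  · left
    refine sum_nonpos fun i hi => mul_nonpos_of_nonpos_of_nonneg ?_ (pow_nonneg hα _)
    have := mem_range.1 hi
    exact sub_nonpos.2 ((hc a b i hab hb (by omega)).1 (by omega))
  · right
    refine sum_nonneg fun i hi => mul_nonneg ?_ (pow_nonneg hα _)
    have := mem_Ico.1 hi
    exact sub_nonneg.2 ((hc a b i hab hb (by omega)).2 (by omega))

/-- If the smaller of two responses is at least as good at `z + 1`, then so it is at `z`. -/
theorem HasMidpointCrossing.geomPotential_le_of_succ {α : ℝ} (hα : 0 < α) (hα1 : α < 1) {n : ℕ}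
    {c : ℕ → ℕ → ℝ} (hc : HasMidpointCrossing n c) {a b z : ℕ} (hab : a < b) (hb : b ≤ n)
    (hz : z < n) (h : geomPotential α n (c a) (z + 1) ≤ geomPotential α n (c b) (z + 1)) :
    geomPotential α n (c a) z ≤ geomPotential α n (c b) z := by
  have hcross := hc.lower_nonpos_or_upper_nonneg hα.le hab hb hz
  rw [← sub_nonpos, ← geomPotential_sub] at h ⊢
  rw [geomPotential_succ_eq _ hz] at h
  rw [geomPotential_eq _ hz]
  set L := lowerPotential α (fun i => c a i - c b i) z
  set U := upperPotential α n (fun i => c a i - c b i) (z + 1)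
  have hL : L ≤ 0 := by
    rcases hcross with hL | hU
    · exact hL
    · by_contra! hL
      have := mul_pos hα hL
      linarith
  have h1 : α * U ≤ α * (-(α * L)) := mul_le_mul_of_nonneg_left (by linarith) hα.le
  have h2 : (1 - α ^ 2) * L ≤ 0 := mul_nonpos_of_nonneg_of_nonpos (by nlinarith) hL
  linarith

/-- On `{0, …, n}`, the function `B` is the pointwise minimum of `f 0, …, f n`. -/
structure IsPointwiseMin (n : ℕ) (f : ℕ → ℕ → ℝ) (B : ℕ → ℝ) : Prop where
  le : ∀ k ≤ n, ∀ z ≤ n, B z ≤ f k z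
  attained : ∀ z ≤ n, ∃ k ≤ n, B z = f k z

/-- With `L` and `U` the two parts of the potential of `c r - c k`, the excess is `L + α * U` at `z`
and at least `α * L + U` at `z + 1`. Nonnegativity at `z` and the crossing force `U ≥ 0`, and the
two differ by `(1 - α ^ 2) * U` after scaling. -/
theorem HasMidpointCrossing.excess_step_right {α : ℝ} (hα : 0 < α) (hα1 : α < 1) {n : ℕ}
    {c : ℕ → ℕ → ℝ} (hc : HasMidpointCrossing n c) {B : ℕ → ℝ}
    (hB : IsPointwiseMin n (fun k => geomPotential α n (c k)) B) {r k z : ℕ} (hz : z < n)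
    (hr : r ≤ n) (hk : k ≤ n) (hrk : r ≤ k) (hBk : B z = geomPotential α n (c k) z) :
    α * (geomPotential α n (c r) z - B z) ≤ geomPotential α n (c r) (z + 1) - B (z + 1) := by
  have hle := hB.le k hk (z + 1) (by omega)
  have hnn := hB.le r hr z (by omega)
  rcases hrk.eq_or_lt with rfl | hlt
  · rw [hBk]; linarith
  have hcross := hc.lower_nonpos_or_upper_nonneg hα.le hlt hk hz
  have e1 := geomPotential_sub α n (c r) (c k) z
  have e2 := geomPotential_sub α n (c r) (c k) (z + 1)
  rw [geomPotential_eq _ hz] at e1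
  rw [geomPotential_succ_eq _ hz] at e2
  set L := lowerPotential α (fun i => c r i - c k i) z
  set U := upperPotential α n (fun i => c r i - c k i) (z + 1)
  have hU : 0 ≤ U := by
    rcases hcross with hL | hU
    · by_contra! hU
      have := mul_pos hα (neg_pos.2 hU)
      linarith
    · exact hU
  have : α * (L + α * U) ≤ α * L + U := by nlinarith [mul_nonneg hα.le hU]
  rw [e1] at this
  rw [hBk]
  linarith

theorem HasMidpointCrossing.excess_step_left {α : ℝ} (hα : 0 < α) (hα1 : α < 1) {n : ℕ}
    {c : ℕ → ℕ → ℝ} (hc : HasMidpointCrossing n c) {B : ℕ → ℝ}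
    (hB : IsPointwiseMin n (fun k => geomPotential α n (c k)) B) {r k z : ℕ} (hz : z < n)
    (hr : r ≤ n) (hkr : k ≤ r) (hBk : B (z + 1) = geomPotential α n (c k) (z + 1)) :
    α * (geomPotential α n (c r) (z + 1) - B (z + 1)) ≤ geomPotential α n (c r) z - B z := by
  have hle := hB.le k (hkr.trans hr) z (by omega)
  have hnn := hB.le r hr (z + 1) (by omega)
  rcases hkr.eq_or_lt with rfl | hlt
  · rw [hBk]; linarith
  have hcross := hc.lower_nonpos_or_upper_nonneg hα.le hlt hr hz
  have e1 := geomPotential_sub α n (c k) (c r) z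
  have e2 := geomPotential_sub α n (c k) (c r) (z + 1)
  rw [geomPotential_eq _ hz] at e1
  rw [geomPotential_succ_eq _ hz] at e2
  set L := lowerPotential α (fun i => c k i - c r i) z
  set U := upperPotential α n (fun i => c k i - c r i) (z + 1)
  have hL : L ≤ 0 := by
    rcases hcross with hL | hU
    · exact hL
    · by_contra! hL
      have := mul_pos hα hL
      linarith
  have : L + α * U ≤ α * (α * L + U) := by nlinarith [mul_nonneg hα.le (neg_nonneg.2 hL)]
  rw [e1, e2] at this
  rw [hBk]
  linarith

/-- Around a suitable point, the excess of the response `r` over the pointwise best response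
satisfies the two one-sided privacy inequalities. -/
theorem HasMidpointCrossing.exists_pivot {α : ℝ} (hα : 0 ≤ α) (hα1 : α < 1) {n : ℕ}
    {c : ℕ → ℕ → ℝ} (hc : HasMidpointCrossing n c) {B : ℕ → ℝ}
    (hB : IsPointwiseMin n (fun k => geomPotential α n (c k)) B) {r : ℕ} (hr : r ≤ n) :
    ∃ m ≤ n,
      (∀ z < m, α * (geomPotential α n (c r) (z + 1) - B (z + 1)) ≤
        geomPotential α n (c r) z - B z) ∧
      ∀ z, m ≤ z → z < n → α * (geomPotential α n (c r) z - B z) ≤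
        geomPotential α n (c r) (z + 1) - B (z + 1) := by
  have hnn : ∀ z ≤ n, 0 ≤ geomPotential α n (c r) z - B z := fun z hz =>
    sub_nonneg.2 (hB.le r hr z hz)
  -- At `α = 0` the right-hand inequality is just nonnegativity, so `0` is a pivot.
  rcases hα.eq_or_lt with rfl | hα
  · exact ⟨0, Nat.zero_le n, fun z hz => absurd hz (Nat.not_lt_zero z), fun z _ hz => by
      simpa using hnn (z + 1) (by omega)⟩
  set h : ℕ → ℝ := fun z => geomPotential α n (c r) z - B z with hh
  -- Having a best response at most `r` propagates from `z + 1` down to `z`.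
  have hmono : ∀ z < n, (∃ k ≤ r, B (z + 1) = geomPotential α n (c k) (z + 1)) →
      ∃ k ≤ r, B z = geomPotential α n (c k) z := by
    rintro z hz ⟨k, hk, hBk⟩
    obtain ⟨k', hk'n, hBk'⟩ := hB.attained z hz.le
    by_cases hk' : k' ≤ r
    · exact ⟨k', hk', hBk'⟩
    · refine ⟨k, hk, le_antisymm (hB.le k (hk.trans hr) z hz.le) ?_⟩
      rw [hBk']
      refine hc.geomPotential_le_of_succ hα hα1 (by omega) hk'n hz ?_
      rw [← hBk]
      exact hB.le k' hk'n (z + 1) hz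
  have hstart : ∀ z < n, ¬ α * h z ≤ h (z + 1) →
      ∃ k ≤ r, B z = geomPotential α n (c k) z := by
    intro z hz hfail
    obtain ⟨k, hkn, hBk⟩ := hB.attained z hz.le
    refine ⟨k, ?_, hBk⟩
    by_contra! hlt
    exact hfail (hc.excess_step_right hα hα1 hB hz hr hkn hlt.le hBk)
  have hdown : ∀ i < n, ¬ α * h i ≤ h (i + 1) → ∀ j ≤ i, α * h (j + 1) ≤ h j := by
    intro i hi hfail j hj
    rcases hj.eq_or_lt with rfl | hlt
    · have h0 := hnn j hi.le
      have h1 := hnn (j + 1) hi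
      have : h (j + 1) ≤ h j := by
        by_contra! hc
        exact hfail ((mul_le_of_le_one_left h0 hα1.le).trans hc.le)
      exact (mul_le_of_le_one_left h1 hα1.le).trans this
    · obtain ⟨k, hk, hBk⟩ : ∃ k ≤ r, B (j + 1) = geomPotential α n (c k) (j + 1) :=
        Nat.decreasingInduction' (P := fun z => ∃ k ≤ r, B z = geomPotential α n (c k) z)
          (fun z hz _ => hmono z (by omega)) hlt (hstart i hi hfail)
      exact hc.excess_step_left hα hα1 hB (by omega) hr hk hBk
  classical
  -- The pivot is the least point from which the right inequality always holds; minimality makes it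
  -- fail just before, so `hdown` applies to everything below.
  by_cases hex : ∃ m, m ≤ n ∧ ∀ z, m ≤ z → z < n → α * h z ≤ h (z + 1)
  · refine ⟨Nat.find hex, (Nat.find_spec hex).1, fun z hz => ?_, (Nat.find_spec hex).2⟩
    obtain ⟨m, hm⟩ : ∃ m, Nat.find hex = m + 1 := ⟨Nat.find hex - 1, by omega⟩
    have hle := (Nat.find_spec hex).1
    have hspec := (Nat.find_spec hex).2
    rw [hm] at hle hspec
    refine hdown m (by omega) (fun hup => ?_) z (by omega)
    refine Nat.find_min hex (by omega : m < Nat.find hex) ⟨by omega, fun w hw hwn => ?_⟩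
    rcases hw.eq_or_lt with rfl | hlt
    · exact hup
    · exact hspec w hlt hwn
  · exact absurd ⟨n, le_rfl, fun z h1 h2 => absurd h2 (by omega)⟩ hex

/-- The pointwise minimum of the potentials is a feasible solution of the dual linear program: on
columns of private mechanisms it bounds the cost of every response from below. -/
theorem HasMidpointCrossing.geomForm_le {α : ℝ} (hα : 0 ≤ α) (hα1 : α < 1) {n : ℕ}
    {c : ℕ → ℕ → ℝ} (hc : HasMidpointCrossing n c) {B : ℕ → ℝ}
    (hB : IsPointwiseMin n (fun k => geomPotential α n (c k)) B) {r : ℕ} (hr : r ≤ n)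
    {u : ℕ → ℝ} (hu : ∀ i ≤ n, 0 ≤ u i)
    (hpriv : ∀ i < n, α * u (i + 1) ≤ u i ∧ α * u i ≤ u (i + 1)) :
    geomForm α n B u ≤ (1 - α ^ 2) * ∑ i ∈ range (n + 1), c r i * u i := by
  obtain ⟨m, hmn, hleft, hright⟩ := hc.exists_pivot hα hα1 hB hr
  -- Expanded around the pivot, each term is a product of an inequality for the excess and the
  -- matching privacy inequality for `u`.
  rw [← geomForm_geomPotential, ← sub_nonneg, ← geomForm_sub_left, geomForm_eq_pivot α hmn]
  refine add_nonneg (add_nonneg (sum_nonneg fun i hi => ?_) (sum_nonneg fun i hi => ?_)) ?_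
  · have := mem_range.1 hi
    exact mul_nonneg (sub_nonneg.2 (hleft i this)) (sub_nonneg.2 (hpriv i (by omega)).1)
  · have := mem_Ico.1 hi
    exact mul_nonneg (sub_nonneg.2 (hright i this.1 this.2)) (sub_nonneg.2 (hpriv i this.2).2)
  · exact mul_nonneg (by nlinarith) (mul_nonneg (sub_nonneg.2 (hB.le r hr m hmn)) (hu m hmn))

/-! ### Databases and query results. -/

section Databases

variable {D : Type*} {n : ℕ} {P : D → Prop}

/-- The neighboring databases whose first `i` rows satisfy the predicate and whose other rows
violate it. -/
theorem exists_database_chain (hPtrue : ∃ a, P a) (hPfalse : ∃ b, ¬ P b) :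
    ∃ ρ : Fin (n + 1) → Fin n → D, (∀ i, countQuery P (ρ i) = i) ∧
      ∀ i : Fin n, Neighbors (ρ i.castSucc) (ρ i.succ) := by
  classical
  obtain ⟨a, ha⟩ := hPtrue
  obtain ⟨b, hb⟩ := hPfalse
  refine ⟨fun i j => if (j : ℕ) < i then a else b, fun i => ?_, fun i => ⟨i, ?_, fun k hk => ?_⟩⟩
  · ext
    have hP : ∀ j : Fin n, P (if (j : ℕ) < i then a else b) ↔ (j : ℕ) < i := fun j => by
      split_ifs with h <;> simp [ha, hb, h]
    simp only [countQuery, hP]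
    rw [Fin.card_filter_val_lt]
    exact min_eq_right (Nat.lt_succ_iff.1 i.2)
  · have : a ≠ b := fun h => hb (h ▸ ha)
    simpa using this.symm
  · have : (k : ℕ) ≠ i := fun h => hk (Fin.ext h)
    simp only [Fin.val_castSucc, Fin.val_succ]
    by_cases h : (k : ℕ) < i
    · rw [if_pos h, if_pos (by omega)]
    · rw [if_neg h, if_neg (by omega)]

/-- Neighboring databases have query results that differ by at most one. -/
theorem Neighbors.countQuery_le {d₁ d₂ : Fin n → D} (h : Neighbors d₁ d₂) :
    (countQuery P d₁ : ℕ) ≤ countQuery P d₂ + 1 := by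
  classical
  obtain ⟨j, -, hj⟩ := h
  simp only [countQuery]
  refine (card_le_card (t := insert j (univ.filter fun k => P (d₂ k))) fun k hk => ?_).trans
    (card_insert_le _ _)
  rw [mem_insert, mem_filter]
  by_cases hkj : k = j
  · exact Or.inl hkj
  · exact Or.inr ⟨mem_univ _, hj k hkj ▸ (mem_filter.1 hk).2⟩

theorem Neighbors.symm {d₁ d₂ : Fin n → D} (h : Neighbors d₁ d₂) : Neighbors d₂ d₁ := by
  obtain ⟨j, hne, hj⟩ := h
  exact ⟨j, hne.symm, fun k hk => (hj k hk).symm⟩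

theorem resultProb_eq {R : Type*} {x : (Fin n → D) → R → ℝ} (hx : IsOblivious P x) {i : Fin (n + 1)}
    {d : Fin n → D} (hd : countQuery P d = i) (r : R) : resultProb P x i r = x d r := by
  have h : ∃ d : Fin n → D, countQuery P d = i := ⟨d, hd⟩
  rw [resultProb, dif_pos h]
  exact hx _ _ (h.choose_spec.trans hd.symm) r

theorem IsMechanism.resultProb {R : Type*} {x : (Fin n → D) → R → ℝ} (hx : IsMechanism x)
    (hP : ∀ i, ∃ d : Fin n → D, countQuery P d = i) : IsMechanism (resultProb P x) := by
  refine ⟨fun i r => ?_, fun i => ?_⟩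
  · rw [GeomPrivacy.resultProb, dif_pos (hP i)]; exact hx.1 _ _
  · have : GeomPrivacy.resultProb P x i = x (hP i).choose := by
      ext r; rw [GeomPrivacy.resultProb, dif_pos (hP i)]
    rw [this]; exact hx.2 _

theorem resultProb_applyRemap {R S : Type*} (x : (Fin n → D) → R → ℝ) (y : R → S → ℝ)
    (hP : ∀ i, ∃ d : Fin n → D, countQuery P d = i) :
    resultProb P (applyRemap y x) = applyRemap y (resultProb P x) := by
  ext i s
  simp only [resultProb, applyRemap, dif_pos (hP i)]

end Databases

/-! ### Remaps of mechanisms. -/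

section Remap

variable {A R S : Type*} {x : A → R → ℝ} {y : R → S → ℝ}

theorem IsMechanism.le_one (hx : IsMechanism x) (a : A) (r : R) : x a r ≤ 1 :=
  le_hasSum (hx.2 a) r fun r' _ => hx.1 a r'

theorem IsMechanism.summable_mul (hx : IsMechanism x) (hy : IsMechanism y) (a : A) (s : S) :
    Summable fun r => x a r * y r s :=
  Summable.of_nonneg_of_le (fun r => mul_nonneg (hx.1 a r) (hy.1 r s))
    (fun r => mul_le_of_le_one_right (hx.1 a r) (hy.le_one r s)) (hx.2 a).summable

theorem IsMechanism.hasSum_applyRemap (hx : IsMechanism x) (hy : IsMechanism y) (a : A) (s : S) :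
    HasSum (fun r => x a r * y r s) (applyRemap y x a s) :=
  (hx.summable_mul hy a s).hasSum

theorem IsMechanism.sum_eq_one [Fintype S] (hy : IsMechanism y) (r : R) : ∑ s, y r s = 1 :=
  (hasSum_fintype (y r)).unique (hy.2 r)

theorem isMechanism_single [Fintype S] [DecidableEq S] (k : R → S) :
    IsMechanism fun r => (Pi.single (k r) 1 : S → ℝ) := by
  refine ⟨fun r s => ?_, fun r => ?_⟩
  · dsimp only
    rw [Pi.single_apply]; split_ifs <;> norm_num
  · have := hasSum_fintype (Pi.single (k r) 1 : S → ℝ)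
    rwa [Fintype.sum_pi_single'] at this

theorem IsMechanism.applyRemap [Fintype S] (hx : IsMechanism x) (hy : IsMechanism y) :
    IsMechanism (applyRemap y x) := by
  refine ⟨fun a s => tsum_nonneg fun r => mul_nonneg (hx.1 a r) (hy.1 r s), fun a => ?_⟩
  have h := hasSum_sum (s := univ) fun s _ => hx.hasSum_applyRemap hy a s
  simp only [← mul_sum, hy.sum_eq_one, mul_one] at h
  rw [(hx.2 a).unique h]
  exact hasSum_fintype _

end Remap

/-! ### Privacy under remaps and optimality of Bayes remaps. -/

section Feasible

variable {D R : Type*} {n : ℕ} {P : D → Prop} {α : ℝ}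

theorem IsFeasible.applyRemap {S : Type*} [Fintype S] {x : (Fin n → D) → R → ℝ}
    (hx : IsFeasible P α x) {y : R → S → ℝ} (hy : IsMechanism y) :
    IsFeasible P α (applyRemap y x) := by
  obtain ⟨hm, ho, hp⟩ := hx
  refine ⟨hm.applyRemap hy, fun d₁ d₂ h s => ?_, fun d₁ d₂ h s => ?_⟩
  · exact tsum_congr fun r => by rw [ho d₁ d₂ h r]
  · have key : ∀ d₁ d₂ : Fin n → D, Neighbors d₁ d₂ →
        α * GeomPrivacy.applyRemap y x d₂ s ≤ GeomPrivacy.applyRemap y x d₁ s := by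
      intro d₁ d₂ h
      refine hasSum_le (fun r => ?_) ((hm.hasSum_applyRemap hy d₂ s).mul_left α)
        (hm.hasSum_applyRemap hy d₁ s)
      rw [← mul_assoc]
      exact mul_le_mul_of_nonneg_right (hp d₁ d₂ h r).1 (hy.1 r s)
    exact ⟨key d₁ d₂ h, key d₂ d₁ h.symm⟩

/-- The expected loss of an induced mechanism, as a sum over the responses of the original one. -/
theorem hasSum_expectedLoss_applyRemap {x : (Fin n → D) → R → ℝ} (hx : IsMechanism x)
    {y : R → Fin (n + 1) → ℝ} (hy : IsMechanism y)
    (hP : ∀ i, ∃ d : Fin n → D, countQuery P d = i)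
    (p : Fin (n + 1) → ℝ) (l : Fin (n + 1) → Fin (n + 1) → ℝ) :
    HasSum (fun r => ∑ k, y r k * ∑ i, resultProb P x i r * p i * l i k)
      (expectedLoss P p l (applyRemap y x)) := by
  have hX := hx.resultProb hP
  have h := hasSum_sum (s := univ) fun i _ =>
    (hasSum_sum (s := univ) fun k _ =>
      (hX.hasSum_applyRemap hy i k).mul_right (l i k)).mul_left (p i)
  rw [expectedLoss, resultProb_applyRemap x y hP]
  refine (congrArg (HasSum · _) (funext fun r => ?_)).mpr h
  simp only [mul_sum]
  rw [sum_comm]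
  exact sum_congr rfl fun i _ => sum_congr rfl fun k _ => by ring

theorem exists_isBayesRemap (x : (Fin n → D) → R → ℝ) (p : Fin (n + 1) → ℝ)
    (l : Fin (n + 1) → Fin (n + 1) → ℝ) : ∃ y, IsBayesRemap P p l x y := by
  choose k hk using fun r => Finite.exists_min fun k => ∑ i, posterior P p x r i * l i k
  exact ⟨fun r => Pi.single (k r) 1, fun r => ⟨k r, hk r, rfl⟩⟩

/-- A minimizer of the posterior loss minimizes the unnormalized posterior loss. -/
theorem sum_resultProb_le_of_posterior_le {x : (Fin n → D) → R → ℝ}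
    (hX : IsMechanism (resultProb P x)) {p : Fin (n + 1) → ℝ} (hp : ∀ i, 0 ≤ p i)
    (l : Fin (n + 1) → Fin (n + 1) → ℝ) {r : R} {k j : Fin (n + 1)}
    (h : ∑ i, posterior P p x r i * l i k ≤ ∑ i, posterior P p x r i * l i j) :
    ∑ i, resultProb P x i r * p i * l i k ≤ ∑ i, resultProb P x i r * p i * l i j := by
  have hnn : ∀ i ∈ univ, 0 ≤ resultProb P x i r * p i := fun i _ => mul_nonneg (hX.1 i r) (hp i)
  rcases (sum_nonneg hnn).eq_or_lt with h0 | hpos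
  -- For a response of total probability zero, division by zero makes the posterior vanish and `h`
  -- carries no information, but both unnormalized sums are zero.
  · have hz := (sum_eq_zero_iff_of_nonneg hnn).1 h0.symm
    rw [sum_congr rfl fun i hi => by rw [hz i hi, zero_mul],
      sum_congr (f := fun i => resultProb P x i r * p i * l i j) rfl fun i hi => by
        rw [hz i hi, zero_mul]]
  · have e : ∀ k, ∑ i, posterior P p x r i * l i k =
        (∑ i, resultProb P x i r * p i * l i k) / ∑ i, resultProb P x i r * p i := fun k => by
      rw [sum_div]
      exact sum_congr rfl fun i _ => by rw [posterior, div_mul_eq_mul_div]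
    rw [e, e] at h
    exact (div_le_div_iff_of_pos_right hpos).1 h

theorem IsBayesRemap.isOptimalRemap {x : (Fin n → D) → R → ℝ} (hx : IsMechanism x)
    (hP : ∀ i, ∃ d : Fin n → D, countQuery P d = i) {p : Fin (n + 1) → ℝ} (hp : ∀ i, 0 ≤ p i)
    {l : Fin (n + 1) → Fin (n + 1) → ℝ} {y : R → Fin (n + 1) → ℝ}
    (hy : IsBayesRemap P p l x y) : IsOptimalRemap P p l x y := by
  choose k hk hyk using hy
  obtain rfl : y = fun r => Pi.single (k r) 1 := funext hyk
  have hym := isMechanism_single k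
  refine ⟨hym, fun y' hy' => ?_⟩
  refine hasSum_le (fun r => ?_) (hasSum_expectedLoss_applyRemap hx hym hP p l)
    (hasSum_expectedLoss_applyRemap hx hy' hP p l)
  set F : Fin (n + 1) → ℝ := fun k => ∑ i, resultProb P x i r * p i * l i k
  have hmin : ∀ j, F (k r) ≤ F j := fun j =>
    sum_resultProb_le_of_posterior_le (hx.resultProb hP) hp l (hk r j)
  calc ∑ j, (Pi.single (k r) 1 : Fin (n + 1) → ℝ) j * F j = F (k r) := by
        simp [Pi.single_apply]
    _ = ∑ j, y' r j * F (k r) := by rw [← sum_mul, hy'.sum_eq_one, one_mul]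
    _ ≤ ∑ j, y' r j * F j := sum_le_sum fun j _ => mul_le_mul_of_nonneg_left (hmin j) (hy'.1 r j)

end Feasible

/-! ### The geometric mechanism. -/

theorem hasSum_two_sided_geometric {α : ℝ} (hα0 : 0 ≤ α) (hα1 : α < 1) (m : ℤ) :
    HasSum (fun z : ℤ => (1 - α) / (1 + α) * α ^ (z - m).natAbs) 1 := by
  have h1 := hasSum_geometric_of_lt_one hα0 hα1
  have h : HasSum (fun z : ℤ => α ^ z.natAbs) ((1 - α)⁻¹ + (1 - α)⁻¹ * α) := by
    refine HasSum.of_nat_of_neg_add_one (by simpa using h1) ?_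
    refine (congrArg (HasSum · _) (funext fun k => ?_)).mpr (h1.mul_right α)
    rw [← pow_succ]
    congr 1
  have h2 := ((Equiv.subRight m).hasSum_iff.mpr h).mul_left ((1 - α) / (1 + α))
  have hne : 1 - α ≠ 0 := by linarith
  have hne' : 1 + α ≠ 0 := by linarith
  have hval : (1 - α) / (1 + α) * ((1 - α)⁻¹ + (1 - α)⁻¹ * α) = 1 := by field_simp
  rw [hval] at h2
  exact h2

section

variable {D : Type*} {n : ℕ} {P : D → Prop} {α : ℝ} {x : (Fin n → D) → ℤ → ℝ}

theorem IsGeometricMechanism.isFeasible (hα0 : 0 ≤ α) (hx : IsGeometricMechanism P α x) :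
    IsFeasible P α x := by
  rcases hx with ⟨hα1, hx⟩ | ⟨rfl, hm, hconst⟩
  · have hw : 0 ≤ (1 - α) / (1 + α) := div_nonneg (by linarith) (by linarith)
    refine ⟨⟨fun d z => ?_, fun d => ?_⟩, fun d₁ d₂ h z => ?_, fun d₁ d₂ h z => ?_⟩
    · rw [hx]; exact mul_nonneg hw (pow_nonneg hα0 _)
    · rw [funext (hx d)]; exact hasSum_two_sided_geometric hα0 hα1 _
    · rw [hx, hx, h]
    · have key : ∀ d₁ d₂ : Fin n → D, Neighbors d₁ d₂ → α * x d₂ z ≤ x d₁ z := by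
        intro d₁ d₂ h
        have h1 := h.countQuery_le (P := P)
        have h2 := h.symm.countQuery_le (P := P)
        rw [hx, hx, mul_left_comm, ← pow_succ']
        exact mul_le_mul_of_nonneg_left (pow_le_pow_of_le_one hα0 hα1.le (by omega)) hw
      exact ⟨key d₁ d₂ h, key d₂ d₁ h.symm⟩
  · exact ⟨hm, fun d₁ d₂ _ => hconst d₁ d₂, fun d₁ d₂ _ z => by simp [hconst d₁ d₂ z]⟩

end

/-! ### Lower bound on the loss and its attainment. -/

section Bounds

variable {D R : Type*} {n : ℕ} {P : D → Prop} {α : ℝ}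

/-- Consecutive rows of an oblivious private mechanism are within a factor `α` of each other. -/
theorem IsFeasible.resultProb_le {x : (Fin n → D) → R → ℝ} (hx : IsFeasible P α x)
    (hPtrue : ∃ a, P a) (hPfalse : ∃ b, ¬ P b) (i : Fin n) (r : R) :
    α * resultProb P x i.succ r ≤ resultProb P x i.castSucc r ∧
      α * resultProb P x i.castSucc r ≤ resultProb P x i.succ r := by
  obtain ⟨ρ, hρ, hnb⟩ := exists_database_chain (n := n) hPtrue hPfalse
  rw [resultProb_eq hx.2.1 (hρ i.castSucc), resultProb_eq hx.2.1 (hρ i.succ)]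
  exact hx.2.2 _ _ (hnb i) r

theorem expectedLoss_constant_remap {x : (Fin n → D) → R → ℝ} (hx : IsMechanism x)
    (hP : ∀ i, ∃ d : Fin n → D, countQuery P d = i) (p : Fin (n + 1) → ℝ)
    (l : Fin (n + 1) → Fin (n + 1) → ℝ) (k : Fin (n + 1)) :
    expectedLoss P p l (applyRemap (fun _ => Pi.single k 1) x) = ∑ i, p i * l i k := by
  rw [expectedLoss, resultProb_applyRemap _ _ hP]
  refine sum_congr rfl fun i _ => ?_
  simp only [applyRemap, tsum_mul_right, ((hx.resultProb hP).2 i).tsum_eq, one_mul]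
  simp [Pi.single_apply]

/-- Without any information about the database, some constant response is optimal. -/
theorem exists_constant_le_expectedLoss {x : (Fin n → D) → Fin (n + 1) → ℝ}
    (hx : IsFeasible P 1 x) (hPtrue : ∃ a, P a) (hPfalse : ∃ b, ¬ P b)
    (hP : ∀ i, ∃ d : Fin n → D, countQuery P d = i) (p : Fin (n + 1) → ℝ)
    (l : Fin (n + 1) → Fin (n + 1) → ℝ) :
    ∃ k, ∑ i, p i * l i k ≤ expectedLoss P p l x := by
  have hX := hx.1.resultProb hP
  have hconst : ∀ i r, resultProb P x i r = resultProb P x 0 r := by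
    intro i r
    induction i using Fin.induction with
    | zero => rfl
    | succ i ih =>
      have := hx.resultProb_le hPtrue hPfalse i r
      rw [one_mul, one_mul] at this
      exact (le_antisymm this.1 this.2).trans ih
  obtain ⟨k, hk⟩ := Finite.exists_min fun k => ∑ i, p i * l i k
  refine ⟨k, ?_⟩
  calc ∑ i, p i * l i k = ∑ r, resultProb P x 0 r * ∑ i, p i * l i k := by
        rw [← sum_mul, hX.sum_eq_one, one_mul]
    _ ≤ ∑ r, resultProb P x 0 r * ∑ i, p i * l i r :=
        sum_le_sum fun r _ => mul_le_mul_of_nonneg_left (hk r) (hX.1 0 r)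
    _ = expectedLoss P p l x := by
        simp only [expectedLoss, hconst, mul_sum]
        rw [sum_comm]
        exact sum_congr rfl fun i _ => sum_congr rfl fun r _ => by ring

/-- The contribution `p i * l i k` of the query result `i` and the response `k` to the expected
loss, indexed by natural numbers. -/
noncomputable def lossWeight (p : Fin (n + 1) → ℝ) (l : Fin (n + 1) → Fin (n + 1) → ℝ)
    (k i : ℕ) : ℝ :=
  p (Fin.ofNat (n + 1) i) * l (Fin.ofNat (n + 1) i) (Fin.ofNat (n + 1) k)

theorem val_ofNat_of_le {i : ℕ} (hi : i ≤ n) : ((Fin.ofNat (n + 1) i : Fin (n + 1)) : ℕ) = i :=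
  Nat.mod_eq_of_lt (Nat.lt_succ_of_le hi)

/-- For `a < b`, the point `i` is at least as close to `a` as to `b` exactly when `2 * i ≤ a + b`.
-/
theorem IsLoss.hasMidpointCrossing {p : Fin (n + 1) → ℝ} (hp : ∀ i, 0 ≤ p i)
    {l : Fin (n + 1) → Fin (n + 1) → ℝ} (hl : IsLoss l) :
    HasMidpointCrossing n (lossWeight p l) := by
  intro a b i hab hb hi
  constructor <;> intro h <;>
  · refine mul_le_mul_of_nonneg_left (hl.2 _ _ _ ?_) (hp _)
    rw [val_ofNat_of_le hi, val_ofNat_of_le hb, val_ofNat_of_le (hab.le.trans hb)]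
    rw [Int.abs_eq_natAbs, Int.abs_eq_natAbs]
    omega

theorem expectedLoss_eq_sum_lossWeight (p : Fin (n + 1) → ℝ)
    (l : Fin (n + 1) → Fin (n + 1) → ℝ) (x : (Fin n → D) → Fin (n + 1) → ℝ) :
    expectedLoss P p l x = ∑ r : Fin (n + 1), ∑ i ∈ range (n + 1),
      lossWeight p l r i * resultProb P x (Fin.ofNat (n + 1) i) r := by
  simp only [expectedLoss, mul_sum]
  rw [sum_comm]
  refine sum_congr rfl fun r _ => ?_
  rw [← Fin.sum_univ_eq_sum_range]
  refine sum_congr rfl fun i _ => ?_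
  simp only [lossWeight, Fin.ofNat_val_eq_self]
  ring

theorem sum_geomForm_resultProb {x : (Fin n → D) → Fin (n + 1) → ℝ}
    (hX : IsMechanism (resultProb P x)) (B : ℕ → ℝ) :
    ∑ r, geomForm α n B (fun i => resultProb P x (Fin.ofNat (n + 1) i) r) =
      geomForm α n B fun _ => 1 := by
  rw [← geomForm_sum_right]
  simp only [hX.sum_eq_one]

/-- Weak duality: the dual solution bounds the expected loss of every private mechanism. -/
theorem IsFeasible.geomForm_one_le_expectedLoss (hα0 : 0 ≤ α) (hα1 : α < 1)
    {x : (Fin n → D) → Fin (n + 1) → ℝ} (hx : IsFeasible P α x)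
    (hPtrue : ∃ a, P a) (hPfalse : ∃ b, ¬ P b)
    (hP : ∀ i, ∃ d : Fin n → D, countQuery P d = i) {p : Fin (n + 1) → ℝ}
    (hp : ∀ i, 0 ≤ p i) {l : Fin (n + 1) → Fin (n + 1) → ℝ} (hl : IsLoss l) {B : ℕ → ℝ}
    (hB : IsPointwiseMin n (fun k => geomPotential α n (lossWeight p l k)) B) :
    geomForm α n B (fun _ => 1) ≤ (1 - α ^ 2) * expectedLoss P p l x := by
  have hX := hx.1.resultProb hP
  rw [← sum_geomForm_resultProb hX, expectedLoss_eq_sum_lossWeight, mul_sum]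
  refine sum_le_sum fun r _ => ?_
  refine (hl.hasMidpointCrossing hp).geomForm_le hα0 hα1 hB (Nat.lt_succ_iff.1 r.2)
    (fun i _ => hX.1 _ _) fun i hi => ?_
  have h := hx.resultProb_le hPtrue hPfalse ⟨i, hi⟩ r
  have e1 : (Fin.ofNat (n + 1) i : Fin (n + 1)) = Fin.castSucc ⟨i, hi⟩ :=
    Fin.ext (val_ofNat_of_le hi.le)
  have e2 : (Fin.ofNat (n + 1) (i + 1) : Fin (n + 1)) = Fin.succ ⟨i, hi⟩ :=
    Fin.ext (val_ofNat_of_le hi)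
  rw [e1, e2]
  exact h

/-- The remap that sends each response, after truncation to `[0, n]`, to a best response attains the
dual bound. -/
theorem expectedLoss_truncated_remap {x : (Fin n → D) → ℤ → ℝ} (hm : IsMechanism x)
    (hx : ∀ d z, x d z = (1 - α) / (1 + α) * α ^ (z - ((countQuery P d : ℕ) : ℤ)).natAbs)
    (hP : ∀ i, ∃ d : Fin n → D, countQuery P d = i) (p : Fin (n + 1) → ℝ)
    (l : Fin (n + 1) → Fin (n + 1) → ℝ) {κ : ℕ → ℕ} (hκ : ∀ z ≤ n, κ z ≤ n) {B : ℕ → ℝ}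
    (hB : ∀ z ≤ n, B z = geomPotential α n (lossWeight p l (κ z)) z) :
    (1 - α ^ 2) * expectedLoss P p l
      (applyRemap (fun z => Pi.single (Fin.ofNat (n + 1) (κ (min z (n : ℤ)).toNat)) 1) x) =
      geomForm α n B fun _ => 1 := by
  set y : ℤ → Fin (n + 1) → ℝ :=
    fun z => Pi.single (Fin.ofNat (n + 1) (κ (min z (n : ℤ)).toNat)) 1
  have hym : IsMechanism y := isMechanism_single _
  have hX := hm.resultProb hP
  rw [← sum_geomForm_resultProb ((hm.applyRemap hym).resultProb hP),
    expectedLoss_eq_sum_lossWeight, mul_sum]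
  refine sum_congr rfl fun r _ => ?_
  -- Complementary slackness: for each `r`, the form at the excess of `r` and the `r`-th column is
  -- to vanish, and it does so for each `z` separately.
  rw [← geomForm_geomPotential, ← sub_eq_zero, ← geomForm_sub_left,
    resultProb_applyRemap _ _ hP]
  set h : ℕ → ℝ := fun i => geomPotential α n (lossWeight p l r) i - B i with hh
  have hsum := hasSum_geomForm_right α n h
    (v := fun z i => resultProb P x (Fin.ofNat (n + 1) i) z * y z r)
    fun i _ => hX.hasSum_applyRemap hym (Fin.ofNat (n + 1) i) r
  refine hsum.unique ?_
  refine (congrArg (HasSum · _) (funext fun z => ?_)).mpr hasSum_zero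
  set m := (min z (n : ℤ)).toNat with hm
  have hmn : m ≤ n := by omega
  have hob : IsOblivious P x := fun d₁ d₂ h z => by rw [hx, hx, h]
  have hv : ∀ i ≤ n, resultProb P x (Fin.ofNat (n + 1) i) z * y z r =
      ((1 - α) / (1 + α) * y z r) * α ^ (z - (i : ℤ)).natAbs := by
    intro i hi
    obtain ⟨d, hd⟩ := hP (Fin.ofNat (n + 1) i)
    rw [resultProb_eq hob hd, hx, hd, val_ofNat_of_le hi]
    ring
  rw [geomForm_congr_right h hv, geomForm_const_mul_right,
    geomForm_geometric α hmn h z (by omega) (by omega)]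
  -- Either `r` is the chosen best response at `m` and has no excess there, or `z` is not mapped to
  -- `r`.
  by_cases hr : r = Fin.ofNat (n + 1) (κ m)
  · have hr' : (r : ℕ) = κ m := by rw [hr, val_ofNat_of_le (hκ m hmn)]
    have : h m = 0 := by rw [hh]; simp only [hr', hB m hmn, sub_self]
    rw [this, zero_mul, mul_zero, mul_zero]
  · have : y z r = 0 := Pi.single_eq_of_ne hr 1
    rw [this, mul_zero, zero_mul]

theorem IsGeometricMechanism.exists_remap_le (hα0 : 0 ≤ α) {x : (Fin n → D) → ℤ → ℝ}
    (hG : IsGeometricMechanism P α x) (hPtrue : ∃ a, P a) (hPfalse : ∃ b, ¬ P b)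
    {p : Fin (n + 1) → ℝ} (hp : ∀ i, 0 ≤ p i) {l : Fin (n + 1) → Fin (n + 1) → ℝ}
    (hl : IsLoss l) {x' : (Fin n → D) → Fin (n + 1) → ℝ} (hx' : IsFeasible P α x') :
    ∃ y, IsMechanism y ∧ expectedLoss P p l (applyRemap y x) ≤ expectedLoss P p l x' := by
  have hP : ∀ i, ∃ d : Fin n → D, countQuery P d = i := by
    obtain ⟨ρ, hρ, -⟩ := exists_database_chain (n := n) hPtrue hPfalse
    exact fun i => ⟨ρ i, hρ i⟩
  have hm := (hG.isFeasible hα0).1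
  rcases hG with ⟨hα1, hx⟩ | ⟨rfl, -, -⟩
  · choose κ hκ hmin using fun z : ℕ => exists_min_image (range (n + 1))
      (fun k => geomPotential α n (lossWeight p l k) z) ⟨0, by simp⟩
    have hκn : ∀ z, κ z ≤ n := fun z => Nat.lt_succ_iff.1 (mem_range.1 (hκ z))
    refine ⟨_, isMechanism_single fun z : ℤ => Fin.ofNat (n + 1) (κ (min z (n : ℤ)).toNat), ?_⟩
    have h1 := expectedLoss_truncated_remap hm hx hP p l (fun z _ => hκn z)
      (B := fun z => geomPotential α n (lossWeight p l (κ z)) z) fun _ _ => rfl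
    have h2 := hx'.geomForm_one_le_expectedLoss hα0 hα1 hPtrue hPfalse hP hp hl
      (B := fun z => geomPotential α n (lossWeight p l (κ z)) z)
      ⟨fun k hk z _ => hmin z k (mem_range.2 (Nat.lt_succ_of_le hk)),
        fun z _ => ⟨κ z, hκn z, rfl⟩⟩
    -- At `α = 1` this factor vanishes and the dual bound is empty, hence the separate case.
    have hpos : 0 < 1 - α ^ 2 := by nlinarith
    exact le_of_mul_le_mul_left (h1.trans_le h2) hpos
  · obtain ⟨k, hk⟩ := exists_constant_le_expectedLoss hx' hPtrue hPfalse hP p l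
    exact ⟨_, isMechanism_single fun _ => k,
      (expectedLoss_constant_remap hm hP p l k).trans_le hk⟩

end Bounds

end GeomPrivacy

open GeomPrivacy in
theorem theorem1 {D : Type*} [Finite D] (n : ℕ) (hn : 1 ≤ n) (P : D → Prop)
    (hPtrue : ∃ a, P a) (hPfalse : ∃ b, ¬ P b)
    (α : ℝ) (hα0 : 0 ≤ α) (hα1 : α ≤ 1)
    (xG : (Fin n → D) → ℤ → ℝ) (hG : IsGeometricMechanism P α xG)
    (p : Fin (n + 1) → ℝ) (hp : IsPrior p)
    (l : Fin (n + 1) → Fin (n + 1) → ℝ) (hl : IsLoss l) :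
    (∃ y : ℤ → Fin (n + 1) → ℝ, IsBayesRemap P p l xG y) ∧
    (∀ y : ℤ → Fin (n + 1) → ℝ, IsBayesRemap P p l xG y → IsOptimalRemap P p l xG y) ∧
    (∀ y : ℤ → Fin (n + 1) → ℝ, IsOptimalRemap P p l xG y →
      IsOptimalMechanism P α p l (applyRemap y xG)) := by
  have hF := hG.isFeasible hα0
  obtain ⟨ρ, hρ, -⟩ := exists_database_chain (n := n) hPtrue hPfalse
  refine ⟨exists_isBayesRemap xG p l, fun y hy => hy.isOptimalRemap hF.1 (fun i => ⟨ρ i, hρ i⟩) hp.1,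
    fun y hy => ⟨hF.applyRemap hy.1, fun x' hx' => ?_⟩⟩
  obtain ⟨y', hy', hle⟩ := hG.exists_remap_le hα0 hPtrue hPfalse hp.1 hl hx'
  exact (hy.2 y' hy').trans hle
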